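/- For every constant $K$ there is a constant $c>0$, depending only on $K$, such that the following holds for every $n\ge 1$. Let $\mathbb F$ be a field and let $f\in\mathbb F[q_1,\dots,q_n]$ be a symmetric polynomial of total degree $d\le K\log n$ that is not constant on $\{0,1\}^n$. Assume that $\operatorname{char}\mathbb F$ is $0$ or larger than $\max\bigl(2^{4n+2\binom n2},\,n^d\bigr)$. Let $h\in\mathbb F[y_1,\dots,y_n]$ be the polynomial with $f=h(e_{1,n}(q),\dots,e_{n,n}(q))$, where $e_{k,N}$ denotes the $k$-th elementary symmetric polynomial in $N$ variables. Let $m=\binom{2n}{2}$, let $w=(w_{i,j})_{1\le i<j\le 2n}$, and define, in the variables $x_1,\dots,x_{2n}$ and $z_{i,j}$ ($1\le i<j\le 2n$), $$f^\star(z,x)=h\bigl(e_{1,m}(w),\dots,e_{n,m}(w)\bigr)\Big|_{w_{i,j}\mapsto z_{i,j}x_ix_j}.$$ Let $\beta\in\mathbb F$ be such that neither $f(q)-\beta=0$ nor $f^\star(z,x)-\beta=0$ has a solution with all variables in $\{0,1\}$. Then every roABP-$\mathrm{IPS}_{\mathrm{LIN}'}$ refutation of $f^\star(z,x)-\beta=0$,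 in any variable order, has size at least $2^{cn}$. Here, writing $v$ for the list of all the variables $x_i$ and $z_{i,j}$, an $\mathrm{IPS}_{\mathrm{LIN}'}$ refutation of $f^\star-\beta=0$ is a polynomial $C(v,y,u)$, with one new variable $y$ and one new variable $u_k$ for each variable $v_k$, such that $C(v,0,0)=0$ and $C\bigl(v,\,f^\star-\beta,\,(v_k^2-v_k)_k\bigr)=1$ as formal polynomials and $C$ has degree at most $1$ in $y$. It is a roABP-$\mathrm{IPS}_{\mathrm{LIN}'}$ refutation if $C$ is given by a read-once oblivious algebraic branching program (roABP). A roABP in $N$ variables consists of an order of the variables and a layered directed graph with vertex layers $V_0,\dots,V_N$, $|V_0|=|V_N|=1$, and edges from $V_{i-1}$ to $V_i$ labelled by univariate polynomials in the $i$-th variable of the order. It computes the sum, over all paths from $V_0$ to $V_N$, of the product of the edge labels. Its size is $N\cdot r\cdot \delta\cdot N$, where $r=\max_i|V_i|$ and $\delta$ is the maximal degree of an edge label. -/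

import Mathlib

/-- `P = 0` has no solution with all variables in `{0, 1}`. -/
def BooleanUnsat {F σ : Type*} [Field F] (P : MvPolynomial σ F) : Prop :=
  ∀ a : σ → F, (∀ i, a i = 0 ∨ a i = 1) → MvPolynomial.eval a P ≠ 0

/-- `P` takes two different values on the Boolean cube. -/
def NonconstantOnCube {F σ : Type*} [Field F] (P : MvPolynomial σ F) : Prop :=
  ∃ a b : σ → F, (∀ i, a i = 0 ∨ a i = 1) ∧ (∀ i, b i = 0 ∨ b i = 1) ∧
    MvPolynomial.eval a P ≠ MvPolynomial.eval b P

/-- A read-once oblivious algebraic branching program over the finite set `τ` of variables.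
There are `card τ` layers of edges, and `order` says which variable is read in which layer.
The vertices of layer `i` are `Fin (layer i)`; the first and the last layer
are the source and the sink. Every edge of a layer is labelled by a univariate polynomial in the
variable of that layer; a missing edge is an edge with label `0`. -/
structure RoABP (F τ : Type*) [Field F] [Fintype τ] where
  order : Fin (Fintype.card τ) ≃ τ
  layer : Fin (Fintype.card τ + 1) → ℕ
  layer_source : layer 0 = 1
  layer_sink : layer (Fin.last _) = 1
  label : (i : Fin (Fintype.card τ)) → Fin (layer i.castSucc) → Fin (layer i.succ) → Polynomial F

namespace RoABP

variable {F τ : Type*} [Field F] [Fintype τ]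

/-- The computed polynomial: the sum over all source-sink paths `q` of the product of the
labels on the edges of `q`. -/
noncomputable def poly (P : RoABP F τ) : MvPolynomial τ F :=
  ∑ q : ((i : Fin (Fintype.card τ + 1)) → Fin (P.layer i)),
    ∏ i : Fin (Fintype.card τ),
      Polynomial.aeval (MvPolynomial.X (P.order i) : MvPolynomial τ F)
        (P.label i (q i.castSucc) (q i.succ))

/-- The maximal number of vertices in a layer. -/
def width (P : RoABP F τ) : ℕ := Finset.univ.sup P.layer

/-- The maximal degree of an edge label. -/
noncomputable def degree (P : RoABP F τ) : ℕ :=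
  Finset.univ.sup fun i : Fin (Fintype.card τ) =>
    Finset.univ.sup fun e : Fin (P.layer i.castSucc) × Fin (P.layer i.succ) =>
      (P.label i e.1 e.2).natDegree

/-- Number of variables times width times degree times depth; the depth of a read-once program
is its number of variables. -/
noncomputable def size (P : RoABP F τ) : ℕ :=
  Fintype.card τ * P.width * P.degree * Fintype.card τ

end RoABP

/-- The variables of an IPS proof: the variables `σ` of the axioms, one placeholder for each
axiom in `ι`, and one placeholder for the Boolean axiom of each variable in `σ`. -/
abbrev IPSVar (σ ι : Type*) : Type _ := σ ⊕ (ι ⊕ σ)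

/-- `C(x, y, z)` is an `IPS_LIN'` refutation of the axioms `f j = 0` and the Boolean axioms:
`C(x, 0, 0) = 0`, `C(x, f, x² - x) = 1`, and `C` has individual degree at most one in each
placeholder `y j`. -/
def IsIPSLinPrimeRefutation {F σ ι : Type*} [Field F] (f : ι → MvPolynomial σ F)
    (C : MvPolynomial (IPSVar σ ι) F) : Prop :=
  MvPolynomial.aeval (Sum.elim MvPolynomial.X fun _ => (0 : MvPolynomial σ F)) C = 0 ∧
  MvPolynomial.aeval (Sum.elim MvPolynomial.X
    (Sum.elim f fun i => (MvPolynomial.X i ^ 2 - MvPolynomial.X i : MvPolynomial σ F))) C = 1 ∧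
  ∀ j : ι, C.degreeOf (Sum.inr (Sum.inl j)) ≤ 1

/-- The pairs `i < j` in `[2n]`. -/
abbrev Pairs (n : ℕ) : Type := {p : Fin (2 * n) × Fin (2 * n) // p.1 < p.2}

/-- The variables of the lifted instance: `x i` for `i ∈ [2n]`, and `z i j` for `i < j`. -/
abbrev LiftVar (n : ℕ) : Type := Fin (2 * n) ⊕ Pairs n

/-- The gadget `w i j ↦ z i j * x i * x j`. -/
noncomputable def gadget (F : Type*) [Field F] (n : ℕ) (p : Pairs n) :
    MvPolynomial (LiftVar n) F :=
  MvPolynomial.X (Sum.inr p) * MvPolynomial.X (Sum.inl p.1.1) * MvPolynomial.X (Sum.inl p.1.2)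

/-- `h(e_1, …, e_n)` with the elementary symmetric polynomials in `n` variables. -/
noncomputable def substEsymm {F : Type*} [Field F] {n : ℕ} (h : MvPolynomial (Fin n) F) :
    MvPolynomial (Fin n) F :=
  MvPolynomial.aeval (fun k : Fin n => MvPolynomial.esymm (Fin n) F (k + 1)) h

/-- `h(e_1, …, e_n)` with the elementary symmetric polynomials in the `binom(2n, 2)` variables
`w i j`, in which the gadget is then substituted. This is `f⋆` for the symmetric polynomial
`f = substEsymm h`; by the fundamental theorem `h` exists and is determined by `f`. -/
noncomputable def liftSymm {F : Type*} [Field F] {n : ℕ} (h : MvPolynomial (Fin n) F) :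
    MvPolynomial (LiftVar n) F :=
  MvPolynomial.aeval
    (fun k : Fin n =>
      MvPolynomial.aeval (gadget F n) (MvPolynomial.esymm (Pairs n) F (k + 1))) h

/-!
A refutation `C`, evaluated at a Boolean point of `(x, z)`, at `y = 1` and at `u = 0`, gives the
inverse of `f⋆ - β` there: its restriction to `u = 0` is linear in `y` without constant term.
Split the `x`-variables into the first and the second half in the order in which the program
reads them, and let `z` select a perfect matching between the halves. If `x` is the indicator of
`S` on the first half and that of `T` on the second, then `f⋆` takes the value of `f` on 0/1
vectors of weight `|S ∩ T|`. Cutting the program between the halves, its width is at least the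
rank of the matrix `g(|S ∩ T|)`, where `g` is the inverse of `f - β` as a function of the weight.

By Newton's formula `g(|S ∩ T|) = ∑_{U ⊆ S ∩ T} Δ^{|U|} g(0)`, so this matrix is `Z D Zᵀ` with `Z`
unitriangular and `D` the diagonal matrix of the differences `Δ^{|U|} g(0)`; its rank is at least
`binom(n, t)` for every `t ≤ n` with `Δ^t g(0) ≠ 0`. As a function of the weight, `f` is a
nonconstant polynomial of degree at most `d`. If `Δ^t g(0)` vanished for all `t ∈ [a, b]`, where
`a + d ≤ b ≤ n`, then `g` would agree on `0, …, b` with a polynomial of degree below `a`, whose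
product with `f - β` would be identically `1`. So some `t` between `(n - d) / 2` and
`n - (n - d) / 2` has `Δ^t g(0) ≠ 0`, and `binom(n, t) ≥ 2 ^ ((n - d) / 2)`.
-/

section CubeEvaluation

open Finset MvPolynomial

theorem eval_aeval_eq_eval {R σ τ : Type*} [CommSemiring R] (a : τ → R) (g : σ → MvPolynomial τ R)
    (p : MvPolynomial σ R) : eval a (aeval g p) = eval (fun i => eval a (g i)) p := by
  simp only [← aeval_eq_eval, comp_aeval_apply]

theorem eval_indicator_esymm {R ι : Type*} [CommSemiring R] [Fintype ι] (S : Finset ι) (k : ℕ) :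
    eval ((S : Set ι).indicator 1) (esymm ι R k) = ((#S).choose k : R) := by
  classical
  simp only [esymm, map_sum, map_prod, eval_X, Set.indicator_apply, mem_coe, Pi.one_apply,
    prod_ite_zero, prod_const_one, sum_boole]
  rw [← card_powersetCard]
  congr 2
  ext T
  rw [mem_filter, mem_powersetCard_univ, mem_powersetCard, subset_iff, and_comm]

theorem eq_indicator_of_forall_eq_zero_or_one {R ι : Type*} [Zero R] [One R] {a : ι → R}
    (ha : ∀ i, a i = 0 ∨ a i = 1) : a = {i | a i = 1}.indicator 1 := by
  classical
  funext i
  by_cases h : a i = 1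
  · simp [h]
  · simp [Set.indicator_apply, (ha i).resolve_right h]

theorem sum_powerset_neg_one_pow_mul_eq_zero {R ι : Type*} [CommRing R] [DecidableEq ι]
    {T : Finset ι} {i : ι} (hi : i ∈ T) {g : Finset ι → R} (hg : ∀ S, g (insert i S) = g S) :
    ∑ S ∈ T.powerset, (-1) ^ (#T - #S) * g S = 0 := by
  obtain ⟨U, hiU, rfl⟩ : ∃ U, i ∉ U ∧ insert i U = T :=
    ⟨T.erase i, notMem_erase i T, insert_erase hi⟩
  rw [sum_powerset_insert hiU, ← sum_add_distrib]
  refine sum_eq_zero fun S hS => ?_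
  have hSU := mem_powerset.1 hS
  have hcard := card_le_card hSU
  rw [hg, card_insert_of_notMem hiU, card_insert_of_notMem fun h => hiU (hSU h),
    Nat.add_sub_add_right, Nat.sub_add_comm hcard, pow_succ]
  ring

theorem exists_mem_eq_zero_of_totalDegree_lt_card {R ι : Type*} [CommSemiring R]
    {f : MvPolynomial ι R} {T : Finset ι} (hT : f.totalDegree < #T) {m : ι →₀ ℕ}
    (hm : m ∈ f.support) : ∃ i ∈ T, m i = 0 := by
  by_contra! hne
  have hTm : #T ≤ m.sum fun _ e => e := calc
    #T ≤ #m.support := card_le_card fun i hi => Finsupp.mem_support_iff.2 (hne i hi)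
    _ = ∑ i ∈ m.support, 1 := card_eq_sum_ones _
    _ ≤ m.sum fun _ e => e :=
      sum_le_sum fun i hi => Nat.one_le_iff_ne_zero.2 (Finsupp.mem_support_iff.1 hi)
  exact (hTm.trans (le_totalDegree hm)).not_gt hT

theorem sum_powerset_neg_one_pow_mul_eval_indicator {R ι : Type*} [CommRing R]
    {f : MvPolynomial ι R} {T : Finset ι} (hT : f.totalDegree < #T) :
    ∑ S ∈ T.powerset, (-1) ^ (#T - #S) * eval ((S : Set ι).indicator 1) f = 0 := by
  classical
  simp only [eval_eq, mul_sum]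
  rw [sum_comm]
  -- A monomial of degree below `#T` avoids some `i ∈ T`, and the terms `S`, `insert i S` cancel.
  refine sum_eq_zero fun m hm => ?_
  obtain ⟨i, hiT, hmi⟩ := exists_mem_eq_zero_of_totalDegree_lt_card hT hm
  refine sum_powerset_neg_one_pow_mul_eq_zero hiT fun S => ?_
  congr 1
  refine prod_congr rfl fun j hj => ?_
  have hji : j ≠ i := by
    rintro rfl
    exact Finsupp.mem_support_iff.1 hj hmi
  simp [Set.indicator_apply, hji]

theorem eval_update_of_degreeOf_le_one {R σ : Type*} [CommRing R] [DecidableEq σ]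
    {p : MvPolynomial σ R} {j : σ} (hp : p.degreeOf j ≤ 1) (a : σ → R) (t : R) :
    eval (Function.update a j t) p =
      (1 - t) * eval (Function.update a j 0) p + t * eval (Function.update a j 1) p := by
  have hmonomial (m : σ →₀ ℕ) (x : R) : ∏ i ∈ m.support, Function.update a j x i ^ m i =
      x ^ m j * (m.erase j).prod fun i e => a i ^ e := by
    rw [← Finsupp.prod, ← Finsupp.mul_prod_erase' m j _ fun _ => pow_zero _,
      Function.update_self]
    congr 1
    refine Finsupp.prod_congr fun i hi => ?_
    rw [Function.update_of_ne (by rintro rfl; simp at hi)]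
  simp only [eval_eq, hmonomial, mul_sum, ← sum_add_distrib]
  refine sum_congr rfl fun m hm => ?_
  have hmj : m j ≤ 1 := (degreeOf_le_iff.1 hp) m hm
  interval_cases m j <;> ring

end CubeEvaluation

section FiniteDifferences

open Finset Polynomial
open scoped Nat

variable {F : Type*} [Field F]

theorem factorial_cast_ne_zero_of_le {R : Type*} [Semiring R] {n j : ℕ} (hn : (n ! : R) ≠ 0)
    (hj : j ≤ n) : (j ! : R) ≠ 0 :=
  ne_zero_of_dvd_ne_zero hn (Nat.cast_dvd_cast (Nat.factorial_dvd_factorial hj))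

theorem injOn_natCast_of_factorial_ne_zero {R : Type*} [Ring R] {n : ℕ} (hn : (n ! : R) ≠ 0) :
    Set.InjOn (Nat.cast : ℕ → R) (Set.Iic n) := by
  intro j hj k hk hjk
  wlog hlt : j < k generalizing j k
  · rcases (not_lt.1 hlt).eq_or_lt with h | h
    exacts [h.symm, (this hk hj hjk.symm h).symm]
  have hdvd : k - j ∣ n ! := Nat.dvd_factorial (Nat.sub_pos_of_lt hlt) ((Nat.sub_le k j).trans hk)
  refine absurd ?_ (ne_zero_of_dvd_ne_zero hn (Nat.cast_dvd_cast hdvd))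
  rw [Nat.cast_sub hlt.le, hjk, sub_self]

theorem factorial_cast_ne_zero_of_ringChar {n : ℕ} (hF : ringChar F = 0 ∨ n < ringChar F) :
    (n ! : F) ≠ 0 := by
  rw [Ne, ringChar.spec]
  rcases CharP.char_is_prime_or_zero F (ringChar F) with hp | h0
  · rw [hp.dvd_factorial, not_le]
    exact hF.resolve_left hp.ne_zero
  · rw [h0, zero_dvd_iff]
    exact n.factorial_ne_zero

theorem apply_eq_sum_choose_smul_fwdDiff_iter {G : Type*} [AddCommGroup G] (g : ℕ → G) (k : ℕ) :
    g k = ∑ j ∈ range (k + 1), k.choose j • (fwdDiff 1)^[j] g 0 := by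
  simpa using shift_eq_sum_fwdDiff_iter 1 g k 0

theorem exists_natDegree_le_eval_natCast_eq {g : ℕ → F} {d b : ℕ} (hd : (d ! : F) ≠ 0)
    (hg : ∀ j, d < j → j ≤ b → (fwdDiff 1)^[j] g 0 = 0) :
    ∃ p : F[X], p.natDegree ≤ d ∧ ∀ k ≤ b, p.eval (k : F) = g k := by
  refine ⟨∑ j ∈ range (d + 1), C ((fwdDiff 1)^[j] g 0 / j !) * descPochhammer F j, ?_,
    fun k hk => ?_⟩
  · refine natDegree_sum_le_of_forall_le _ _ fun j hj => (natDegree_C_mul_le _ _).trans ?_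
    rw [descPochhammer_natDegree]
    exact Nat.lt_succ_iff.1 (mem_range.1 hj)
  have hterm : ∀ j ∈ range (d + 1),
      (C ((fwdDiff 1)^[j] g 0 / j !) * descPochhammer F j).eval (k : F) =
        k.choose j • (fwdDiff 1)^[j] g 0 := by
    intro j hj
    have := factorial_cast_ne_zero_of_le hd (Nat.lt_succ_iff.1 (mem_range.1 hj))
    rw [eval_mul, eval_C, descPochhammer_eval_eq_descFactorial,
      Nat.descFactorial_eq_factorial_mul_choose, nsmul_eq_mul]
    push_cast
    field_simp
  rw [eval_finsetSum, sum_congr rfl hterm, apply_eq_sum_choose_smul_fwdDiff_iter g k]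
  rcases le_total d k with hdk | hkd
  · refine sum_subset (range_subset_range.2 (by omega)) fun j hjk hjd => ?_
    rw [mem_range] at hjk hjd
    rw [hg j (by omega) (by omega), smul_zero]
  · refine (sum_subset (range_subset_range.2 (by omega)) fun j _ hjk => ?_).symm
    rw [Nat.choose_eq_zero_of_lt (by rw [mem_range] at hjk; omega), zero_smul]

theorem exists_fwdDiff_iter_ne_zero_of_eval_mul_eq_one {p : F[X]} {g : ℕ → F} {a b : ℕ}
    (hb : (b ! : F) ≠ 0) (hp : 0 < p.natDegree) (hab : a + p.natDegree ≤ b)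
    (hg : ∀ k ≤ b, p.eval (k : F) * g k = 1) : ∃ t ∈ Set.Icc a b, (fwdDiff 1)^[t] g 0 ≠ 0 := by
  by_contra! hzero
  -- `g` agrees on `0, …, b` with a polynomial `q` of degree below `a`, and `p * q - 1` then has
  -- too many roots.
  obtain ⟨q, hq, hqg⟩ := exists_natDegree_le_eval_natCast_eq (d := a - 1) (b := b)
    (factorial_cast_ne_zero_of_le hb (by omega)) fun j hj hjb => hzero j ⟨by omega, hjb⟩
  have hdegree : (p * q - 1).degree < #(Iic b) := by
    refine degree_le_natDegree.trans_lt (Nat.cast_lt.2 ?_)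
    have := natDegree_sub_le (p * q) 1
    have := natDegree_mul_le (p := p) (q := q)
    rw [natDegree_one] at *
    rw [Nat.card_Iic]
    omega
  have hpq : p * q = 1 := by
    refine eq_of_degree_sub_lt_of_eval_index_eq (v := Nat.cast) (Iic b) ?_ hdegree fun k hk => ?_
    · simpa using injOn_natCast_of_factorial_ne_zero hb
    · rw [eval_mul, hqg k (mem_Iic.1 hk), hg k (mem_Iic.1 hk), eval_one]
  exact hp.ne' (natDegree_eq_zero_of_isUnit (IsUnit.of_mul_eq_one q hpq))

end FiniteDifferences

section IntersectionMatrix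

open Finset

/-- The matrix of the zeta function of a finite order, with the larger element as row index. -/
def zetaMatrix (R α : Type*) [Zero R] [One R] [LE α] [DecidableLE α] : Matrix α α R :=
  Matrix.of fun a b => if b ≤ a then 1 else 0

theorem det_zetaMatrix {R α : Type*} [CommRing R] [PartialOrder α] [DecidableLE α] [Fintype α]
    [DecidableEq α] : (zetaMatrix R α).det = 1 := by
  let e : LinearExtension α ≃ α := Equiv.refl α
  have : Fintype (LinearExtension α) := ‹Fintype α›
  rw [← Matrix.det_submatrix_equiv_self e, Matrix.det_of_isLowerTriangular]
  · simp [zetaMatrix]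
  · intro a b (hab : a < b)
    refine if_neg fun hba : e b ≤ e a => ?_
    have hle : toLinearExtension (e b) ≤ toLinearExtension (e a) := toLinearExtension.monotone hba
    exact hab.not_ge hle

theorem of_card_inter_eq_zetaMatrix_mul {R ι : Type*} [CommRing R] [Fintype ι] [DecidableEq ι]
    (g : ℕ → R) : (Matrix.of fun S T : Finset ι => g #(S ∩ T)) = zetaMatrix R (Finset ι) *
      (Matrix.diagonal (fun S : Finset ι => (fwdDiff 1)^[#S] g 0) *
        (zetaMatrix R (Finset ι)).transpose) := by
  ext S T
  rw [Matrix.of_apply, apply_eq_sum_choose_smul_fwdDiff_iter g,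
    ← sum_powerset_apply_card fun j => (fwdDiff 1)^[j] g 0, Matrix.mul_apply]
  simp only [Matrix.diagonal_mul, Matrix.transpose_apply, zetaMatrix, Matrix.of_apply, mul_ite,
    mul_one, mul_zero, ite_mul, one_mul, zero_mul, ← ite_and, ← sum_filter]
  refine sum_congr ?_ fun _ _ => rfl
  ext U
  rw [mem_powerset, subset_inter_iff, mem_filter_univ, and_comm]

theorem choose_card_le_rank_of_fwdDiff_iter_ne_zero {F ι : Type*} [Field F] [Fintype ι]
    [DecidableEq ι] {g : ℕ → F} {t : ℕ} (ht : (fwdDiff 1)^[t] g 0 ≠ 0) :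
    (Fintype.card ι).choose t ≤ (Matrix.of fun S T : Finset ι => g #(S ∩ T)).rank := by
  classical
  rw [of_card_inter_eq_zetaMatrix_mul,
    Matrix.rank_mul_eq_right_of_isUnit_det _ _ (by simp [det_zetaMatrix]),
    Matrix.rank_mul_eq_left_of_isUnit_det _ _ (by simp [det_zetaMatrix]), Matrix.rank_diagonal,
    ← card_univ, ← card_powersetCard, Fintype.card_subtype]
  refine card_le_card fun S hS => ?_
  simpa [(mem_powersetCard.1 hS).2] using ht

theorem two_pow_le_add_choose {a s t : ℕ} (hs : a ≤ s) (ht : a ≤ t) :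
    2 ^ a ≤ (s + t).choose t := by
  induction a generalizing s t with
  | zero => exact Nat.choose_pos (Nat.le_add_left t s)
  | succ a ih =>
    obtain ⟨s, rfl⟩ := Nat.exists_eq_add_one.2 (a.succ_pos.trans_le hs)
    obtain ⟨t, rfl⟩ := Nat.exists_eq_add_one.2 (a.succ_pos.trans_le ht)
    have hchoose : 2 ^ a ≤ (s + t).choose t := ih (by omega) (by omega)
    calc 2 ^ (a + 1) ≤ (s + t).choose t + (s + t).choose t := by omega
      _ ≤ (s + t + 1).choose t + (s + t + 1).choose (t + 1) :=
        add_le_add (Nat.choose_le_choose t (Nat.le_succ _)) (Nat.le_add_right _ _)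
      _ = (s + 1 + (t + 1)).choose (t + 1) := by
        rw [← Nat.choose_succ_succ, show s + 1 + (t + 1) = s + t + 1 + 1 by omega]

end IntersectionMatrix

section PathCut

open Finset

/-- `o` only supplies values at the coordinates that `f`, respectively `g`, ignores. -/
theorem sum_mul_eq_sum_sum_mul_of_dependsOn {R ι : Type*} {V : ι → Type*} [CommSemiring R]
    [Fintype ι] [LinearOrder ι] [∀ i, Fintype (V i)] [∀ i, DecidableEq (V i)] (c : ι)
    {f g : (∀ i, V i) → R} (o : ∀ i, V i) (hf : DependsOn f (Set.Iic c))
    (hg : DependsOn g (Set.Ici c)) :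
    ∑ q, f q * g q = ∑ s : V c,
      (∑ q : ∀ i : {i // i ≤ c}, V i with q ⟨c, le_rfl⟩ = s,
        f fun i => if hi : i ≤ c then q ⟨i, hi⟩ else o i) *
      ∑ q : ∀ i : {i // ¬ i ≤ c}, V i,
        g fun i => if hi : i ≤ c then Function.update o c s i else q ⟨i, hi⟩ := by
  let cut := Equiv.piEquivPiSubtypeProd (· ≤ c) V
  have hfcut (q₁ q₂) : f (cut.symm (q₁, q₂)) =
      f fun i => if hi : i ≤ c then q₁ ⟨i, hi⟩ else o i := by
    refine hf fun i hi => ?_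
    simp [cut, Set.mem_Iic.1 hi]
  have hgcut (q₁ q₂) : g (cut.symm (q₁, q₂)) =
      g fun i => if hi : i ≤ c then Function.update o c (q₁ ⟨c, le_rfl⟩) i else q₂ ⟨i, hi⟩ := by
    refine hg fun i hi => ?_
    rcases (Set.mem_Ici.1 hi).eq_or_lt with rfl | hlt
    · simp [cut]
    · simp [cut, hlt.not_ge]
  simp only [← cut.symm.sum_comp, Fintype.sum_prod_type, hfcut, hgcut, ← mul_sum]
  rw [← sum_fiberwise univ fun q => q ⟨c, le_rfl⟩]
  refine sum_congr rfl fun s _ => ?_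
  rw [sum_mul]
  refine sum_congr rfl fun q hq => ?_
  rw [(mem_filter.1 hq).2]

theorem rank_sum_mul_le_card_of_dependsOn {R κ κ' ι : Type*} {V : ι → Type*} [CommRing R]
    [Nontrivial R] [Fintype κ'] [Fintype ι] [LinearOrder ι] [∀ i, Fintype (V i)] (c : ι)
    {f : κ → (∀ i, V i) → R} {g : κ' → (∀ i, V i) → R} (hf : ∀ S, DependsOn (f S) (Set.Iic c))
    (hg : ∀ T, DependsOn (g T) (Set.Ici c)) :
    (Matrix.of fun S T => ∑ q, f S q * g T q).rank ≤ Fintype.card (V c) := by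
  classical
  rcases isEmpty_or_nonempty (∀ i, V i) with _ | ⟨⟨o⟩⟩
  · simp only [univ_eq_empty, sum_empty]
    exact Matrix.rank_zero.trans_le (Nat.zero_le _)
  · simp only [sum_mul_eq_sum_sum_mul_of_dependsOn c o (hf _) (hg _)]
    exact (Matrix.rank_mul_le_left (Matrix.of _) (Matrix.of _)).trans (Matrix.rank_le_card_width _)

end PathCut

namespace RoABP

open Finset MvPolynomial

variable {F τ : Type*} [Field F] [Fintype τ]

theorem layer_le_width (P : RoABP F τ) (i : Fin (Fintype.card τ + 1)) : P.layer i ≤ P.width :=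
  le_sup (f := P.layer) (mem_univ i)

theorem one_le_width (P : RoABP F τ) : 1 ≤ P.width :=
  P.layer_source ▸ P.layer_le_width 0

theorem natDegree_label_le_degree (P : RoABP F τ) (i : Fin (Fintype.card τ))
    (s : Fin (P.layer i.castSucc)) (t : Fin (P.layer i.succ)) :
    (P.label i s t).natDegree ≤ P.degree :=
  (le_sup (f := fun e : Fin (P.layer i.castSucc) × Fin (P.layer i.succ) =>
    (P.label i e.1 e.2).natDegree) (mem_univ (s, t))).trans
    (le_sup (f := fun i => univ.sup fun e : Fin (P.layer i.castSucc) × Fin (P.layer i.succ) =>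
      (P.label i e.1 e.2).natDegree) (mem_univ i))

theorem exists_poly_eq_C_of_degree_eq_zero {P : RoABP F τ} (hP : P.degree = 0) :
    ∃ c : F, P.poly = C c := by
  have hlabel : ∀ i s t, P.label i s t = Polynomial.C ((P.label i s t).coeff 0) := fun i s t =>
    Polynomial.eq_C_of_natDegree_le_zero (hP ▸ P.natDegree_label_le_degree i s t)
  refine ⟨∑ q : (i : Fin (Fintype.card τ + 1)) → Fin (P.layer i),
    ∏ i : Fin (Fintype.card τ), (P.label i (q i.castSucc) (q i.succ)).coeff 0, ?_⟩
  simp only [poly, map_sum, map_prod]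
  refine sum_congr rfl fun q _ => prod_congr rfl fun i _ => ?_
  rw [hlabel, Polynomial.aeval_C, algebraMap_eq, Polynomial.coeff_C_zero]

theorem eval_poly (P : RoABP F τ) (a : τ → F) :
    eval a P.poly = ∑ q : (i : Fin (Fintype.card τ + 1)) → Fin (P.layer i),
      ∏ i : Fin (Fintype.card τ),
        (P.label i (q i.castSucc) (q i.succ)).eval (a (P.order i)) := by
  simp only [poly, map_sum, map_prod, ← coe_aeval_eq_eval, RingHom.coe_coe,
    ← Polynomial.aeval_algHom_apply, aeval_X, Polynomial.coe_aeval_eq_eval]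

theorem rank_eval_le_width {κ κ' : Type*} [Fintype κ'] (P : RoABP F τ)
    (k : Fin (Fintype.card τ)) {a : κ → κ' → τ → F} {x : κ → τ → F} {y : κ' → τ → F}
    (hx : ∀ v, P.order.symm v < k → ∀ S T, a S T v = x S v)
    (hy : ∀ v, k ≤ P.order.symm v → ∀ S T, a S T v = y T v) :
    (Matrix.of fun S T => eval (a S T) P.poly).rank ≤ P.width := by
  let f (S : κ) (q : (i : Fin (Fintype.card τ + 1)) → Fin (P.layer i)) : F :=
    ∏ i with i < k, (P.label i (q i.castSucc) (q i.succ)).eval (x S (P.order i))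
  let g (T : κ') (q : (i : Fin (Fintype.card τ + 1)) → Fin (P.layer i)) : F :=
    ∏ i with ¬ i < k, (P.label i (q i.castSucc) (q i.succ)).eval (y T (P.order i))
  have hf (S : κ) : DependsOn (f S) (Set.Iic k.castSucc) := fun q q' hq =>
    prod_congr rfl fun i hi => by
      have hik : i < k := (mem_filter.1 hi).2
      rw [hq i.castSucc (Fin.castSucc_le_castSucc_iff.2 hik.le),
        hq i.succ (Fin.succ_le_castSucc_iff.2 hik)]
  have hg (T : κ') : DependsOn (g T) (Set.Ici k.castSucc) := fun q q' hq =>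
    prod_congr rfl fun i hi => by
      have hki : k ≤ i := not_lt.1 (mem_filter.1 hi).2
      rw [hq i.castSucc (Fin.castSucc_le_castSucc_iff.2 hki),
        hq i.succ (Fin.castSucc_lt_succ_iff.2 hki).le]
  have heval (S : κ) (T : κ') : eval (a S T) P.poly = ∑ q, f S q * g T q := by
    rw [eval_poly]
    refine sum_congr rfl fun q _ => ?_
    rw [← prod_filter_mul_prod_filter_not univ (· < k)]
    congr 1 <;> refine prod_congr rfl fun i hi => ?_
    · rw [hx _ (by simpa using hi)]
    · rw [hy _ (by simpa using hi)]
  simp only [heval]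
  calc _ ≤ Fintype.card (Fin (P.layer k.castSucc)) :=
        rank_sum_mul_le_card_of_dependsOn k.castSucc hf hg
    _ ≤ P.width := (Fintype.card_fin _).trans_le (P.layer_le_width _)

end RoABP

namespace IsIPSLinPrimeRefutation

open MvPolynomial

variable {F σ ι : Type*} [Field F]

theorem eval_mul_eval_eq_one {f : MvPolynomial σ F} {C : MvPolynomial (IPSVar σ Unit) F}
    (hC : IsIPSLinPrimeRefutation (fun _ => f) C) {v : σ → F} (hv : ∀ i, v i = 0 ∨ v i = 1) :
    eval (Sum.elim v (Sum.elim 1 0)) C * eval v f = 1 := by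
  classical
  obtain ⟨hC₀, hC₁, hdegree⟩ := hC
  have hupdate (t : F) : Sum.elim v (Sum.elim (fun _ => t) 0) =
      Function.update (Sum.elim v 0 : IPSVar σ Unit → F) (Sum.inr (Sum.inl ())) t := by
    funext i
    rcases i with _ | ⟨⟨⟩⟩ | _ <;> simp [Function.update]
  have haffine (t : F) : eval (Sum.elim v (Sum.elim (fun _ => t) 0)) C =
      (1 - t) * eval (Sum.elim v (Sum.elim 0 0)) C +
        t * eval (Sum.elim v (Sum.elim 1 0)) C := by
    rw [hupdate, eval_update_of_degreeOf_le_one (hdegree ()), ← hupdate, ← hupdate]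
    rfl
  have hzero : eval (Sum.elim v (Sum.elim 0 0)) C = 0 := by
    have := congrArg (eval v) hC₀
    rw [eval_aeval_eq_eval, map_zero] at this
    convert this using 2
    congr 1
    funext i
    rcases i with _ | _ | _ <;> simp
  have hone : eval (Sum.elim v (Sum.elim (fun _ => eval v f) 0)) C = 1 := by
    have := congrArg (eval v) hC₁
    rw [eval_aeval_eq_eval, map_one] at this
    convert this using 2
    congr 1
    funext i
    rcases i with _ | _ | i
    · simp
    · simp
    · rcases hv i with h | h <;> simp [h]
  rw [haffine, hzero, mul_zero, zero_add] at hone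
  rw [mul_comm, hone]

theorem degree_pos [Fintype σ] [Fintype ι] {f : ι → MvPolynomial σ F} {P : RoABP F (IPSVar σ ι)}
    (hP : IsIPSLinPrimeRefutation f P.poly) : 0 < P.degree := by
  rw [Nat.pos_iff_ne_zero]
  intro hdegree
  obtain ⟨c, hc⟩ := RoABP.exists_poly_eq_C_of_degree_eq_zero hdegree
  obtain ⟨hP₀, hP₁, -⟩ := hP
  rw [hc, aeval_C] at hP₀ hP₁
  exact zero_ne_one (hP₀.symm.trans hP₁)

end IsIPSLinPrimeRefutation

section WeightValue

open Finset MvPolynomial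
open scoped Nat

/-- The value of `h(e_1, …, e_n)` at a 0/1 vector of weight `s`, in any number of variables. -/
noncomputable def weightValue {R : Type*} [CommSemiring R] {n : ℕ} (h : MvPolynomial (Fin n) R)
    (s : ℕ) : R :=
  eval (fun k : Fin n => (s.choose (k + 1) : R)) h

variable {F : Type*} [Field F] {n : ℕ}

theorem eval_indicator_substEsymm (h : MvPolynomial (Fin n) F) (S : Finset (Fin n)) :
    eval ((S : Set (Fin n)).indicator 1) (substEsymm h) = weightValue h #S := by
  simp only [substEsymm, weightValue, eval_aeval_eq_eval, eval_indicator_esymm]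

theorem eval_liftSymm (h : MvPolynomial (Fin n) F) {a : LiftVar n → F} {S : Finset (Pairs n)}
    (ha : ∀ p, eval a (gadget F n p) = (S : Set (Pairs n)).indicator 1 p) :
    eval a (liftSymm h) = weightValue h #S := by
  simp only [liftSymm, weightValue, eval_aeval_eq_eval, ha, eval_indicator_esymm]

theorem fwdDiff_iter_weightValue_eq_zero {h : MvPolynomial (Fin n) F} {t : ℕ}
    (ht : (substEsymm h).totalDegree < t) (htn : t ≤ n) :
    (fwdDiff 1)^[t] (weightValue h) 0 = 0 := by
  obtain ⟨T, -, rfl⟩ := exists_subset_card_eq (s := (univ : Finset (Fin n))) (by simpa using htn)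
  rw [← sum_powerset_neg_one_pow_mul_eval_indicator ht]
  simp only [eval_indicator_substEsymm]
  rw [sum_powerset_apply_card fun s => (-1) ^ (#T - s) * weightValue h s,
    fwdDiff_iter_eq_sum_shift]
  refine sum_congr rfl fun k _ => ?_
  simp only [zsmul_eq_mul, nsmul_eq_mul, smul_eq_mul, mul_one, zero_add]
  push_cast
  ring

theorem exists_natDegree_le_eval_eq_weightValue {h : MvPolynomial (Fin n) F}
    (hF : (n ! : F) ≠ 0) (hd : (substEsymm h).totalDegree ≤ n) :
    ∃ p : Polynomial F, p.natDegree ≤ (substEsymm h).totalDegree ∧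
      ∀ k ≤ n, p.eval (k : F) = weightValue h k :=
  exists_natDegree_le_eval_natCast_eq (factorial_cast_ne_zero_of_le hF hd) fun _ =>
    fwdDiff_iter_weightValue_eq_zero

theorem NonconstantOnCube.exists_weightValue_ne {h : MvPolynomial (Fin n) F}
    (hne : NonconstantOnCube (substEsymm h)) :
    ∃ j ≤ n, ∃ k ≤ n, weightValue h j ≠ weightValue h k := by
  classical
  obtain ⟨a, b, ha, hb, hab⟩ := hne
  rw [eq_indicator_of_forall_eq_zero_or_one ha, eq_indicator_of_forall_eq_zero_or_one hb,
    ← Set.coe_toFinset {i | a i = 1}, ← Set.coe_toFinset {i | b i = 1},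
    eval_indicator_substEsymm, eval_indicator_substEsymm] at hab
  exact ⟨_, card_finset_fin_le _, _, card_finset_fin_le _, hab⟩

theorem NonconstantOnCube.nonempty {σ : Type*} {f : MvPolynomial σ F}
    (hf : NonconstantOnCube f) : Nonempty σ := by
  obtain ⟨a, b, -, -, hab⟩ := hf
  by_contra hσ
  rw [not_nonempty_iff] at hσ
  exact hab (congrArg (eval · f) (Subsingleton.elim a b))

theorem exists_fwdDiff_iter_inv_weightValue_sub_ne_zero {h : MvPolynomial (Fin n) F} {β : F}
    {a b : ℕ} (hF : (n ! : F) ≠ 0) (hne : NonconstantOnCube (substEsymm h))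
    (hβ : ∀ k ≤ n, weightValue h k ≠ β) (hab : a + (substEsymm h).totalDegree ≤ b) (hb : b ≤ n) :
    ∃ t ∈ Set.Icc a b, (fwdDiff 1)^[t] (fun k => (weightValue h k - β)⁻¹) 0 ≠ 0 := by
  obtain ⟨p, hpd, hp⟩ := exists_natDegree_le_eval_eq_weightValue hF (h := h) (by omega)
  obtain ⟨j, hj, k, hk, hjk⟩ := hne.exists_weightValue_ne
  have hp_pos : 0 < p.natDegree := by
    refine Nat.pos_of_ne_zero fun hp₀ => hjk ?_
    rw [← hp j hj, ← hp k hk, Polynomial.eq_C_of_natDegree_eq_zero hp₀, Polynomial.eval_C,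
      Polynomial.eval_C]
  refine exists_fwdDiff_iter_ne_zero_of_eval_mul_eq_one (p := p - Polynomial.C β)
    (factorial_cast_ne_zero_of_le hF hb) ?_ ?_ fun k hk => ?_
  · rwa [Polynomial.natDegree_sub_C]
  · rw [Polynomial.natDegree_sub_C]
    omega
  · rw [Polynomial.eval_sub, Polynomial.eval_C, hp k (hk.trans hb)]
    exact mul_inv_cancel₀ (sub_ne_zero.2 (hβ k (hk.trans hb)))

end WeightValue

section Matching

open Finset MvPolynomial

variable {n : ℕ}

/-- The pair matched with index `i` when `e` splits `Fin (2 * n)` into two halves: its elements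
are the `i`-th elements of the two halves, sorted as `Pairs n` requires. -/
def matchingPair (e : Fin n ⊕ Fin n ≃ Fin (2 * n)) (i : Fin n) : Pairs n :=
  ⟨(min (e (Sum.inl i)) (e (Sum.inr i)), max (e (Sum.inl i)) (e (Sum.inr i))),
    min_lt_max.2 (e.injective.ne Sum.inl_ne_inr)⟩

theorem matchingPair_injective (e : Fin n ⊕ Fin n ≃ Fin (2 * n)) :
    Function.Injective (matchingPair e) := by
  intro i j hij
  obtain ⟨hmin, hmax⟩ := Prod.mk.inj (Subtype.mk.inj hij)
  have hi : e (Sum.inl i) ≠ e (Sum.inr j) := e.injective.ne Sum.inl_ne_inr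
  have hj : e (Sum.inl j) ≠ e (Sum.inr i) := e.injective.ne Sum.inl_ne_inr
  exact Sum.inl_injective (e.injective (by grind))

/-- The point whose `x`-part is the 0/1 vector of `S` on the first half of `e` and that of `T` on
the second half, and whose `z`-part selects the matching of the two halves. -/
noncomputable def matchingPoint (R : Type*) [Zero R] [One R] (e : Fin n ⊕ Fin n ≃ Fin (2 * n))
    (S T : Finset (Fin n)) : LiftVar n → R :=
  Sum.elim (Sum.elim ((S : Set (Fin n)).indicator 1) ((T : Set (Fin n)).indicator 1) ∘ e.symm)
    ((Set.range (matchingPair e)).indicator 1)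

variable {F : Type*} [Field F]

theorem matchingPoint_eq_zero_or_one (e : Fin n ⊕ Fin n ≃ Fin (2 * n)) (S T : Finset (Fin n))
    (v : LiftVar n) : matchingPoint F e S T v = 0 ∨ matchingPoint F e S T v = 1 := by
  rcases v with j | p
  · obtain ⟨i | i, rfl⟩ := e.surjective j <;>
      simp only [matchingPoint, Sum.elim_inl, Sum.elim_inr, Function.comp_apply,
        Equiv.symm_apply_apply] <;>
      exact Set.indicator_eq_zero_or_self _ _ _
  · exact Set.indicator_eq_zero_or_self _ _ _

theorem eval_gadget_matchingPoint (e : Fin n ⊕ Fin n ≃ Fin (2 * n)) (S T : Finset (Fin n))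
    (p : Pairs n) : eval (matchingPoint F e S T) (gadget F n p) =
      (((S ∩ T).map ⟨matchingPair e, matchingPair_injective e⟩ : Finset (Pairs n)) :
        Set (Pairs n)).indicator 1 p := by
  simp only [gadget, map_mul, eval_X]
  by_cases hp : p ∈ Set.range (matchingPair e)
  · obtain ⟨i, rfl⟩ := hp
    have hx : matchingPoint F e S T (Sum.inl (matchingPair e i).1.1) *
        matchingPoint F e S T (Sum.inl (matchingPair e i).1.2) =
        ((S ∩ T : Finset (Fin n)) : Set (Fin n)).indicator 1 i := by
      rw [coe_inter, Set.inter_indicator_one]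
      refine (fn_min_mul_fn_max (fun j => matchingPoint F e S T (Sum.inl j)) _ _).trans ?_
      simp [matchingPoint]
    have hz : matchingPoint F e S T (Sum.inr (matchingPair e i)) = 1 :=
      Set.indicator_of_mem (Set.mem_range_self i) _
    rw [mul_assoc, hx, hz, one_mul, coe_map, Function.Embedding.coeFn_mk,
      Set.indicator_image (matchingPair_injective e)]
    rfl
  · have hz : matchingPoint F e S T (Sum.inr p) = 0 := Set.indicator_of_notMem hp _
    rw [hz, zero_mul, zero_mul, Set.indicator_of_notMem]
    simp only [coe_map, Set.mem_image, not_exists, not_and]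
    exact fun i _ hi => hp ⟨i, hi⟩

theorem eval_liftSymm_matchingPoint (h : MvPolynomial (Fin n) F)
    (e : Fin n ⊕ Fin n ≃ Fin (2 * n)) (S T : Finset (Fin n)) :
    eval (matchingPoint F e S T) (liftSymm h) = weightValue h #(S ∩ T) := by
  rw [eval_liftSymm h (eval_gadget_matchingPoint e S T), card_map]

theorem IsIPSLinPrimeRefutation.eval_matchingPoint_mul_eq_one {h : MvPolynomial (Fin n) F} {β : F}
    {p : MvPolynomial (IPSVar (LiftVar n) Unit) F}
    (hp : IsIPSLinPrimeRefutation (fun _ => liftSymm h - C β) p)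
    (e : Fin n ⊕ Fin n ≃ Fin (2 * n)) (S T : Finset (Fin n)) :
    eval (Sum.elim (matchingPoint F e S T) (Sum.elim 1 0)) p *
      (weightValue h #(S ∩ T) - β) = 1 := by
  have := hp.eval_mul_eval_eq_one (matchingPoint_eq_zero_or_one e S T)
  rwa [map_sub, eval_C, eval_liftSymm_matchingPoint] at this

theorem IsIPSLinPrimeRefutation.weightValue_ne {h : MvPolynomial (Fin n) F} {β : F}
    {p : MvPolynomial (IPSVar (LiftVar n) Unit) F}
    (hp : IsIPSLinPrimeRefutation (fun _ => liftSymm h - C β) p) {k : ℕ} (hk : k ≤ n) :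
    weightValue h k ≠ β := by
  obtain ⟨S, -, rfl⟩ := exists_subset_card_eq (s := (univ : Finset (Fin n))) (by simpa using hk)
  have := hp.eval_matchingPoint_mul_eq_one (finSumFinEquiv.trans (finCongr (two_mul n).symm)) S S
  rw [inter_self] at this
  exact sub_ne_zero.1 (right_ne_zero_of_mul_eq_one this)

theorem exists_sumEquiv_forall_lt_forall_le {α : Type*} [LinearOrder α] (hn : 0 < n)
    {pos : Fin (2 * n) → α} (hpos : Function.Injective pos) :
    ∃ (e : Fin n ⊕ Fin n ≃ Fin (2 * n)) (k : α),
      (∀ i, pos (e (Sum.inl i)) < k) ∧ ∀ j, k ≤ pos (e (Sum.inr j)) := by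
  have hsort : StrictMono (pos ∘ Tuple.sort pos) :=
    (Tuple.monotone_sort pos).strictMono_of_injective (hpos.comp (Tuple.sort pos).injective)
  refine ⟨(finSumFinEquiv.trans (finCongr (two_mul n).symm)).trans (Tuple.sort pos),
    pos (Tuple.sort pos ⟨n, by omega⟩), fun i => hsort ?_, fun j => hsort.monotone ?_⟩ <;>
    simp [Fin.lt_def, Fin.le_def]

theorem IsIPSLinPrimeRefutation.rank_inv_weightValue_sub_le_width {h : MvPolynomial (Fin n) F}
    {β : F} {P : RoABP F (IPSVar (LiftVar n) Unit)} (hn : 0 < n)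
    (hP : IsIPSLinPrimeRefutation (fun _ => liftSymm h - C β) P.poly) :
    (Matrix.of fun S T : Finset (Fin n) => (weightValue h #(S ∩ T) - β)⁻¹).rank ≤ P.width := by
  obtain ⟨e, k, hfirst, hsecond⟩ := exists_sumEquiv_forall_lt_forall_le hn
    (P.order.symm.injective.comp (Sum.inl_injective.comp Sum.inl_injective))
  have hinv (S T : Finset (Fin n)) : (weightValue h #(S ∩ T) - β)⁻¹ =
      eval (Sum.elim (matchingPoint F e S T) (Sum.elim 1 0)) P.poly :=
    (eq_inv_of_mul_eq_one_left (hP.eval_matchingPoint_mul_eq_one e S T)).symm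
  simp only [hinv]
  refine P.rank_eval_le_width k (x := fun S => Sum.elim (matchingPoint F e S ∅) (Sum.elim 1 0))
    (y := fun T => Sum.elim (matchingPoint F e ∅ T) (Sum.elim 1 0))
    (fun v hv S T => ?_) fun v hv S T => ?_ <;> rcases v with (j | p) | v
  · obtain ⟨i | i, rfl⟩ := e.surjective j
    · simp [matchingPoint]
    · exact absurd hv (hsecond i).not_gt
  · rfl
  · rfl
  · obtain ⟨i | i, rfl⟩ := e.surjective j
    · exact absurd hv (hfirst i).not_ge
    · simp [matchingPoint]
  · rfl
  · rfl

end Matching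

section LogarithmicDegree

theorem exists_pos_forall_mul_le_half_sub_add_two (K : ℝ) : ∃ c : ℝ, 0 < c ∧
    ∀ n d : ℕ, (d : ℝ) ≤ K * Real.log n → c * n ≤ ((n - d) / 2 + 2 : ℕ) := by
  have hlog := (Real.isLittleO_log_id_atTop.const_mul_left K).bound (c := 1 / 2) (by norm_num)
  obtain ⟨N, hN⟩ := Filter.eventually_atTop.1 (tendsto_natCast_atTop_atTop.eventually hlog)
  refine ⟨min (1 / 4) (1 / (N + 1)), by positivity, fun n d hd => ?_⟩
  rcases lt_or_ge n N with hnN | hNn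
  · calc min (1 / 4) (1 / ((N : ℝ) + 1)) * n ≤ 1 / (N + 1) * (N + 1) := by
          gcongr
          exacts [min_le_right _ _, by exact_mod_cast hnN.le.trans N.le_succ]
      _ ≤ ((n - d) / 2 + 2 : ℕ) := by
        rw [one_div_mul_cancel (by positivity)]
        exact_mod_cast Nat.succ_le_of_lt (by omega)
  · have hdn : 2 * d ≤ n := by
      have := (le_abs_self _).trans (hN n hNn)
      simp only [id, RCLike.norm_natCast] at this
      have : 2 * (d : ℝ) ≤ n := by linarith
      exact_mod_cast this
    calc min (1 / 4) (1 / ((N : ℝ) + 1)) * n ≤ 1 / 4 * n := by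
          gcongr
          exact min_le_left _ _
      _ ≤ ((n - d) / 2 + 2 : ℕ) := by
        have : (n : ℝ) ≤ 4 * ((n - d) / 2 + 2 : ℕ) := by
          exact_mod_cast (by omega : n ≤ 4 * ((n - d) / 2 + 2))
        linarith

theorem exists_pos_forall_rpow_mul_le_two_pow (K : ℝ) : ∃ c : ℝ, 0 < c ∧
    ∀ n d : ℕ, (d : ℝ) ≤ K * Real.log n → (2 : ℝ) ^ (c * n) ≤ (2 ^ ((n - d) / 2 + 2) : ℕ) := by
  obtain ⟨c, hc, hcn⟩ := exists_pos_forall_mul_le_half_sub_add_two K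
  refine ⟨c, hc, fun n d hd => ?_⟩
  rw [Nat.cast_pow, Nat.cast_two, ← Real.rpow_natCast]
  exact Real.rpow_le_rpow_of_exponent_le one_le_two (hcn n d hd)

end LogarithmicDegree

section LowerBound

open MvPolynomial

variable {F : Type*} [Field F] {n : ℕ} {h : MvPolynomial (Fin n) F} {β : F}
  {P : RoABP F (IPSVar (LiftVar n) Unit)}

theorem two_pow_half_sub_totalDegree_le_width (hF : ringChar F = 0 ∨ n < ringChar F)
    (hne : NonconstantOnCube (substEsymm h))
    (hP : IsIPSLinPrimeRefutation (fun _ => liftSymm h - C β) P.poly) :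
    2 ^ ((n - (substEsymm h).totalDegree) / 2) ≤ P.width := by
  set d := (substEsymm h).totalDegree
  set a := (n - d) / 2 with ha
  rcases le_or_gt n d with hnd | hdn
  · rw [ha, Nat.sub_eq_zero_of_le hnd]
    exact P.one_le_width
  obtain ⟨t, ⟨hat, htb⟩, ht⟩ := exists_fwdDiff_iter_inv_weightValue_sub_ne_zero (a := a)
    (b := n - a) (factorial_cast_ne_zero_of_ringChar hF) hne (fun _ => hP.weightValue_ne)
    (by omega) (Nat.sub_le n a)
  calc 2 ^ a ≤ (n - t + t).choose t := two_pow_le_add_choose (by omega) hat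
    _ = (Fintype.card (Fin n)).choose t := by
      rw [Nat.sub_add_cancel (htb.trans (Nat.sub_le n a)), Fintype.card_fin]
    _ ≤ _ := choose_card_le_rank_of_fwdDiff_iter_ne_zero ht
    _ ≤ P.width := hP.rank_inv_weightValue_sub_le_width (by omega)

theorem mainTheorem5_general (hF : ringChar F = 0 ∨ n < ringChar F)
    (hne : NonconstantOnCube (substEsymm h))
    (hP : IsIPSLinPrimeRefutation (fun _ => liftSymm h - C β) P.poly) :
    2 ^ ((n - (substEsymm h).totalDegree) / 2 + 2) ≤ P.size := by
  have hn : 0 < n := Fin.pos_iff_nonempty.2 hne.nonempty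
  have hcard : 2 ≤ Fintype.card (IPSVar (LiftVar n) Unit) := by
    simp only [Fintype.card_sum, Fintype.card_fin, Fintype.card_unit]
    omega
  calc 2 ^ ((n - (substEsymm h).totalDegree) / 2 + 2)
      = 2 * 2 ^ ((n - (substEsymm h).totalDegree) / 2) * 1 * 2 := by ring
    _ ≤ P.size := by
      rw [RoABP.size]
      gcongr
      exacts [two_pow_half_sub_totalDegree_le_width hF hne hP, hP.degree_pos]

end LowerBound

theorem mainTheorem5 (K : ℝ) :
    ∃ c : ℝ, 0 < c ∧
      ∀ (n : ℕ), 1 ≤ n →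
      ∀ (F : Type*) [Field F] (f h : MvPolynomial (Fin n) F) (β : F),
        f.IsSymmetric →
        f = substEsymm h →
        (f.totalDegree : ℝ) ≤ K * Real.log n →
        (ringChar F = 0 ∨
          max (2 ^ (4 * n + 2 * n.choose 2)) (n ^ f.totalDegree) < ringChar F) →
        NonconstantOnCube f →
        BooleanUnsat (f - MvPolynomial.C β) →
        BooleanUnsat (liftSymm h - MvPolynomial.C β) →
        ∀ P : RoABP F (IPSVar (LiftVar n) Unit),
          IsIPSLinPrimeRefutation (fun _ : Unit => liftSymm h - MvPolynomial.C β) P.poly →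
          (2 : ℝ) ^ (c * n) ≤ (P.size : ℝ) := by
  obtain ⟨c, hc, hcn⟩ := exists_pos_forall_rpow_mul_le_two_pow K
  refine ⟨c, hc, fun n _ F _ f h β _ hf hd hchar hne _ _ P hP => ?_⟩
  subst hf
  have hn : n ≤ 2 ^ (4 * n + 2 * n.choose 2) :=
    n.lt_two_pow_self.le.trans (Nat.pow_le_pow_right two_pos (by omega))
  have hF : ringChar F = 0 ∨ n < ringChar F :=
    hchar.imp_right (hn.trans (le_max_left _ _)).trans_lt
  exact (hcn n _ hd).trans (Nat.cast_le.2 (mainTheorem5_general hF hne hP))
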